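/- There is an absolute constant $c>0$ such that the following holds for every integer $d\ge 2$. A convex body is a compact convex set with non-empty interior. (i) Let $K_1,\dots,K_n$ be closed convex sets in $\mathbb{R}^d$ whose intersection $K=K_1\cap\dots\cap K_n$ is a convex body. Then there is a set $\sigma\subseteq\{1,\dots,n\}$ with $|\sigma|\le 2d$ such that $K_\sigma=\bigcap_{i\in\sigma}K_i$ satisfies both $$\operatorname{vol}_d K_\sigma\le (cd)^{3d/2}\,\operatorname{vol}_d K\qquad\text{and}\qquad \operatorname{diam}K_\sigma\le 2d^2\,\operatorname{diam}K .$$ (ii) Let $v(d)$ (respectively $\delta(d)$) be the infimum of all $t\in[0,\infty]$ such that from every finite family $\mathcal F$ of convex bodies in $\mathbb{R}^d$ one can select at most $2d$ members whose intersection has volume at most $t\cdot\operatorname{vol}_d(\bigcap\mathcal F)$ (respectively diameter at most $t\cdot\operatorname{diam}(\bigcap\mathcal F)$). Then $v(d)\le (cd)^{3d/2}$ and $\delta(d)\le 2d^2$. -/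

import Mathlib

open scoped ENNReal

/-- A convex body: a compact convex set with non-empty interior. -/
def IsConvexBody {d : ℕ} (K : Set (EuclideanSpace ℝ (Fin d))) : Prop :=
  Convex ℝ K ∧ IsCompact K ∧ (interior K).Nonempty

/-- The quantitative Helly constant `v(d)` for the volume: the least `v` such that from every finite
family of convex bodies in `ℝ^d` one may select at most `2 * d` members whose intersection has
volume at most `v` times the volume of the intersection of the whole family. -/
noncomputable def volumeHellyConst (d : ℕ) : ℝ≥0∞ :=
  sInf {v : ℝ≥0∞ | ∀ (n : ℕ) (K : Fin n → Set (EuclideanSpace ℝ (Fin d))),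
    (∀ i, IsConvexBody (K i)) →
      ∃ σ : Finset (Fin n), σ.card ≤ 2 * d ∧
        MeasureTheory.volume (⋂ i ∈ σ, K i) ≤ v * MeasureTheory.volume (⋂ i, K i)}

/-- The quantitative Helly constant `δ(d)` for the diameter: the least `δ` such that from every
finite family of convex bodies in `ℝ^d` one may select at most `2 * d` members whose intersection
has diameter at most `δ` times the diameter of the intersection of the whole family. -/
noncomputable def diameterHellyConst (d : ℕ) : ℝ≥0∞ :=
  sInf {δ : ℝ≥0∞ | ∀ (n : ℕ) (K : Fin n → Set (EuclideanSpace ℝ (Fin d))),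
    (∀ i, IsConvexBody (K i)) →
      ∃ σ : Finset (Fin n), σ.card ≤ 2 * d ∧
        Metric.ediam (⋂ i ∈ σ, K i) ≤ δ * Metric.ediam (⋂ i, K i)}

open Filter Topology MeasureTheory
open scoped InnerProductSpace

/-! An affine map carries the maximal-volume ellipsoid of the intersection to the unit ball. Each
set then contains the ball, so its polar lies in the ball. Let V be the union of these polars: each
point of V is a linear constraint implied by a single set, so choosing 2d points of V costs at most
2d sets.

Maximality is used only through a first-order perturbation, `exists_contact`, a dual form of John's
decomposition of the identity. It bounds the polar of V by the radius d (`norm_le_of_mem_polar`) and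
gives the Dvoretzky–Rogers determinant bound (`exists_det_sq_ge`).

Take w₁,…,w_d in V with maximal |det|. The point -d⁻² ∑ wᵢ lies in the closed hull of V, and
Carathéodory with the origin as a free vertex writes it with only d points vᵢ of V. The constraints
wᵢ and vᵢ confine x to a simplex whose volume the determinant controls. By maximality every y in V
has coordinates in [-1,1] with respect to w, whence ⟪y,x⟫ ≥ -d(d+2): a reflected copy of the
selected intersection, shrunk by d(d+2) ≤ 2d², lies in the full one. The same selection thus serves
volume and diameter.

For (ii) the intersection may have empty interior. Non-empty ones are thickened and a limit is
taken; empty ones fall to Helly's theorem. -/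

/-! ### Perturbing the maximal ball: contact points. -/

theorem eventually_one_lt_det_one_add_smul {d : ℕ}
    (H : EuclideanSpace ℝ (Fin d) →L[ℝ] EuclideanSpace ℝ (Fin d))
    (hH : 0 < LinearMap.trace ℝ _ (H : EuclideanSpace ℝ (Fin d) →ₗ[ℝ] EuclideanSpace ℝ (Fin d))) :
    ∀ᶠ ε : ℝ in 𝓝[>] 0, 1 < (1 + ε • H).det := by
  set b := (EuclideanSpace.basisFun (Fin d) ℝ).toBasis
  set M := LinearMap.toMatrix b b (H : EuclideanSpace ℝ (Fin d) →ₗ[ℝ] EuclideanSpace ℝ (Fin d))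
  have htr : M.trace = LinearMap.trace ℝ _
      (H : EuclideanSpace ℝ (Fin d) →ₗ[ℝ] EuclideanSpace ℝ (Fin d)) :=
    (LinearMap.trace_eq_matrix_trace ℝ b _).symm
  have hdet : ∀ ε : ℝ, (1 + ε • H).det = (1 + ε • M).det := fun ε => by
    rw [ContinuousLinearMap.det, ← LinearMap.det_toMatrix b]
    congr 1
    simp only [ContinuousLinearMap.toLinearMap_add, ContinuousLinearMap.toLinearMap_smul, map_add, map_smul]
    congr 1
    exact LinearMap.toMatrix_one b
  obtain ⟨p, hp⟩ : ∃ p : Polynomial ℝ, ∀ ε : ℝ,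
      (1 + ε • M).det = 1 + M.trace * ε + p.eval ε * ε ^ 2 := ⟨_, fun ε => Matrix.det_one_add_smul ε M⟩
  have hcont : Continuous fun ε : ℝ => M.trace + p.eval ε * ε := by fun_prop
  have h0 : ∀ᶠ ε : ℝ in 𝓝 0, 0 < M.trace + p.eval ε * ε := by
    apply hcont.continuousAt.eventually
    apply lt_mem_nhds
    simpa [htr] using hH
  filter_upwards [h0.filter_mono nhdsWithin_le_nhds, self_mem_nhdsWithin] with ε h1 h2
  rw [hdet, hp]
  have := mul_pos (Set.mem_Ioi.1 h2) h1
  nlinarith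

/-- A first order inequality for a violated constraint of a perturbed unit ball. -/
theorem contact_estimate {d : ℕ} {y z v : EuclideanSpace ℝ (Fin d)}
    {H : EuclideanSpace ℝ (Fin d) →L[ℝ] EuclideanSpace ℝ (Fin d)} {ε : ℝ} (hε : 0 < ε)
    (hεv : ε * ‖v‖ ≤ 1) (hy : ‖y‖ ≤ 1) (hz : ‖z‖ ≤ 1)
    (h : 1 < ⟪y, ε • v + (1 + ε • H) z⟫_ℝ) :
    1 - ε * (‖v‖ + ‖H‖) ≤ ‖y‖ ∧ -(ε * ‖H‖ ^ 2) ≤ ⟪y, H y⟫_ℝ + ⟪y, v⟫_ℝ := by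
  set G := ContinuousLinearMap.adjoint H
  have hG : ‖G‖ = ‖H‖ := by simp [G]
  have hGy : ‖G y‖ ≤ ‖H‖ := by
    calc ‖G y‖ ≤ ‖G‖ * ‖y‖ := G.le_opNorm y
      _ ≤ ‖H‖ * 1 := by rw [hG]; gcongr
      _ = ‖H‖ := mul_one _
  have h1 : ⟪y, ε • v + (1 + ε • H) z⟫_ℝ = ε * ⟪y, v⟫_ℝ + ⟪y + ε • G y, z⟫_ℝ := by
    simp [G, inner_add_right, inner_add_left, inner_smul_right, inner_smul_left,
      ContinuousLinearMap.adjoint_inner_left]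
  have h2 : ⟪y + ε • G y, z⟫_ℝ ≤ ‖y + ε • G y‖ := by
    calc _ ≤ ‖y + ε • G y‖ * ‖z‖ := real_inner_le_norm _ _
      _ ≤ ‖y + ε • G y‖ * 1 := by gcongr
      _ = _ := mul_one _
  have h3 : |⟪y, v⟫_ℝ| ≤ ‖v‖ := by
    calc _ ≤ ‖y‖ * ‖v‖ := abs_real_inner_le_norm _ _
      _ ≤ 1 * ‖v‖ := by gcongr
      _ = _ := one_mul _
  obtain ⟨h3a, h3b⟩ := abs_le.1 h3
  have h4 : 1 - ε * ⟪y, v⟫_ℝ < ‖y + ε • G y‖ := by linarith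
  have h5 : ε * ⟪y, v⟫_ℝ ≤ ε * ‖v‖ := by gcongr
  constructor
  · have : ‖y + ε • G y‖ ≤ ‖y‖ + ε * ‖H‖ := by
      calc _ ≤ ‖y‖ + ‖ε • G y‖ := norm_add_le _ _
        _ = ‖y‖ + ε * ‖G y‖ := by rw [norm_smul, Real.norm_of_nonneg hε.le]
        _ ≤ _ := by gcongr
    linarith
  -- Squaring makes the estimate first order: since ‖y‖ ≤ 1 the constant terms cancel, and a factor
  -- ε can be divided out.
  · have h6 : (1 - ε * ⟪y, v⟫_ℝ) ^ 2 < ‖y + ε • G y‖ ^ 2 :=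
      pow_lt_pow_left₀ h4 (by linarith) two_ne_zero
    have h7 : ‖y + ε • G y‖ ^ 2 = ‖y‖ ^ 2 + 2 * (ε * ⟪y, H y⟫_ℝ) + ε ^ 2 * ‖G y‖ ^ 2 := by
      rw [norm_add_sq_real, inner_smul_right, norm_smul, mul_pow, Real.norm_of_nonneg hε.le,
        ContinuousLinearMap.adjoint_inner_right, real_inner_comm]
    have h8 : ‖G y‖ ^ 2 ≤ ‖H‖ ^ 2 := by gcongr
    have h9 : ‖y‖ ^ 2 ≤ 1 := pow_le_one₀ (norm_nonneg _) hy
    have h10 : ε ^ 2 * ‖G y‖ ^ 2 ≤ ε ^ 2 * ‖H‖ ^ 2 := by gcongr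
    have h11 : 0 ≤ ε * (2 * (⟪y, H y⟫_ℝ + ⟪y, v⟫_ℝ) + ε * ‖H‖ ^ 2) := by
      nlinarith [sq_nonneg (ε * ⟪y, v⟫_ℝ)]
    have h12 := nonneg_of_mul_nonneg_right h11 hε
    have : 0 ≤ ε * ‖H‖ ^ 2 := by positivity
    linarith

/-- `V` is a compact subset of the unit ball, and the unit ball has maximal volume among the
ellipsoids contained in the polar of `V`. -/
structure IsJohnPosition {d : ℕ} (V : Set (EuclideanSpace ℝ (Fin d))) : Prop where
  isCompact : IsCompact V
  norm_le : ∀ y ∈ V, ‖y‖ ≤ 1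
  det_le : ∀ (A : EuclideanSpace ℝ (Fin d) →L[ℝ] EuclideanSpace ℝ (Fin d))
    (v : EuclideanSpace ℝ (Fin d)),
    (∀ z, ‖z‖ ≤ 1 → ∀ y ∈ V, ⟪y, v + A z⟫_ℝ ≤ 1) → |A.det| ≤ 1

namespace IsJohnPosition

variable {d : ℕ} {V : Set (EuclideanSpace ℝ (Fin d))}

/-- Since det(1 + εH) > 1 for small ε > 0, the ellipsoid εv + (1 + εH)B violates some constraint y
in V. By `contact_estimate` these y accumulate, as ε → 0, at a contact point with the required sign.
-/
theorem exists_contact_of_trace_pos (hV : IsJohnPosition V)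
    (H : EuclideanSpace ℝ (Fin d) →L[ℝ] EuclideanSpace ℝ (Fin d)) (v : EuclideanSpace ℝ (Fin d))
    (hH : 0 < LinearMap.trace ℝ _ (H : EuclideanSpace ℝ (Fin d) →ₗ[ℝ] EuclideanSpace ℝ (Fin d))) :
    ∃ u ∈ V, ‖u‖ = 1 ∧ 0 ≤ ⟪u, H u⟫_ℝ + ⟪u, v⟫_ℝ := by
  have key : ∀ n : ℕ, ∃ ε : ℝ, 0 < ε ∧ ε < 1 / ((n : ℝ) + 1) ∧ ∃ y ∈ V,
      1 - ε * (‖v‖ + ‖H‖) ≤ ‖y‖ ∧ -(ε * ‖H‖ ^ 2) ≤ ⟪y, H y⟫_ℝ + ⟪y, v⟫_ℝ := by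
    intro n
    have h1 : ∀ᶠ ε : ℝ in 𝓝[>] 0, ε < 1 / ((n : ℝ) + 1) :=
      (gt_mem_nhds (by positivity)).filter_mono nhdsWithin_le_nhds
    have h2 : ∀ᶠ ε : ℝ in 𝓝[>] 0, ε * ‖v‖ < 1 := by
      have : Continuous fun ε : ℝ => ε * ‖v‖ := by fun_prop
      refine (this.continuousAt.eventually (gt_mem_nhds ?_)).filter_mono nhdsWithin_le_nhds
      simp
    obtain ⟨ε, hdet, hn, hv, hε⟩ :=
      ((eventually_one_lt_det_one_add_smul H hH).and (h1.and (h2.and self_mem_nhdsWithin))).exists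
    refine ⟨ε, hε, hn, ?_⟩
    by_contra hcon
    have := hV.det_le (1 + ε • H) (ε • v) fun z hz y hy => by
      by_contra hlt
      exact hcon ⟨y, hy, contact_estimate hε hv.le (hV.norm_le y hy) hz (not_le.1 hlt)⟩
    exact absurd ((le_abs_self _).trans this) (not_le.2 hdet)
  choose ε hε hεn y hyV hy1 hy2 using key
  have hε0 : Tendsto ε atTop (𝓝 0) :=
    squeeze_zero (fun n => (hε n).le) (fun n => (hεn n).le) tendsto_one_div_add_atTop_nhds_zero_nat
  obtain ⟨u, huV, φ, hφ, hu⟩ := hV.isCompact.tendsto_subseq hyV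
  have hε1 := hε0.comp hφ.tendsto_atTop
  refine ⟨u, huV, le_antisymm (hV.norm_le u huV) ?_, ?_⟩
  · have := le_of_tendsto_of_tendsto' ((hε1.mul_const (‖v‖ + ‖H‖)).const_sub 1) hu.norm
      fun n => hy1 (φ n)
    simpa using this
  · have hc : Continuous fun y : EuclideanSpace ℝ (Fin d) => ⟪y, H y⟫_ℝ + ⟪y, v⟫_ℝ := by fun_prop
    have := le_of_tendsto_of_tendsto' (hε1.mul_const (‖H‖ ^ 2)).neg
      ((hc.tendsto u).comp hu) fun n => hy2 (φ n)
    simpa using this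

theorem exists_contact (hV : IsJohnPosition V) (hd : 0 < d)
    (H : EuclideanSpace ℝ (Fin d) →L[ℝ] EuclideanSpace ℝ (Fin d)) (v : EuclideanSpace ℝ (Fin d)) :
    ∃ u ∈ V, ‖u‖ = 1 ∧
      LinearMap.trace ℝ _ (H : EuclideanSpace ℝ (Fin d) →ₗ[ℝ] EuclideanSpace ℝ (Fin d)) / d ≤
        ⟪u, H u⟫_ℝ + ⟪u, v⟫_ℝ := by
  set t := LinearMap.trace ℝ _ (H : EuclideanSpace ℝ (Fin d) →ₗ[ℝ] EuclideanSpace ℝ (Fin d))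
  have hd' : (0 : ℝ) < d := by exact_mod_cast hd
  have approx : ∀ δ : ℝ, 0 < δ → ∃ u ∈ V, ‖u‖ = 1 ∧ t / d - δ ≤ ⟪u, H u⟫_ℝ + ⟪u, v⟫_ℝ := by
    intro δ hδ
    -- Shifting H by a multiple of the identity makes its trace δd > 0, and on unit vectors it
    -- changes the quadratic form by the constant δ - t/d.
    obtain ⟨u, hu, hu1, h⟩ := hV.exists_contact_of_trace_pos
      (H + (δ - t / d) • ContinuousLinearMap.id ℝ (EuclideanSpace ℝ (Fin d))) v (by
        simp only [ContinuousLinearMap.toLinearMap_add, ContinuousLinearMap.toLinearMap_smul, map_add, map_smul,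
          smul_eq_mul]
        have hid : LinearMap.trace ℝ _ (ContinuousLinearMap.id ℝ (EuclideanSpace ℝ (Fin d)) :
            EuclideanSpace ℝ (Fin d) →ₗ[ℝ] EuclideanSpace ℝ (Fin d)) = d := by
          rw [ContinuousLinearMap.coe_id, LinearMap.trace_id, finrank_euclideanSpace_fin]
        rw [hid]
        change 0 < t + _
        have : t + (δ - t / d) * d = δ * d := by field_simp; ring
        rw [this]
        positivity)
    refine ⟨u, hu, hu1, ?_⟩
    simp only [add_apply, smul_apply,
      ContinuousLinearMap.id_apply, inner_add_right, inner_smul_right,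
      real_inner_self_eq_norm_sq, hu1] at h
    linarith
  have hcomp : IsCompact (V ∩ {u | ‖u‖ = 1}) :=
    hV.isCompact.inter_right (isClosed_eq continuous_norm continuous_const)
  obtain ⟨u₀, h₀, h₀', -⟩ := approx 1 one_pos
  have hc : Continuous fun y : EuclideanSpace ℝ (Fin d) => ⟪y, H y⟫_ℝ + ⟪y, v⟫_ℝ := by fun_prop
  obtain ⟨u, ⟨huV, hu1⟩, hmax⟩ := hcomp.exists_isMaxOn ⟨u₀, h₀, h₀'⟩ hc.continuousOn
  refine ⟨u, huV, hu1, le_of_forall_pos_le_add fun δ hδ => ?_⟩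
  obtain ⟨w, hw, hw1, h⟩ := approx δ hδ
  have : ⟪w, H w⟫_ℝ + ⟪w, v⟫_ℝ ≤ ⟪u, H u⟫_ℝ + ⟪u, v⟫_ℝ := hmax ⟨hw, hw1⟩
  linarith

/-- In John position, the polar of `V` lies in the ball of radius `d`. -/
theorem norm_le_of_mem_polar (hV : IsJohnPosition V) (hd : 0 < d) {x : EuclideanSpace ℝ (Fin d)}
    (hx : ∀ y ∈ V, ⟪y, x⟫_ℝ ≤ 1) : ‖x‖ ≤ d := by
  have hd' : (0 : ℝ) < d := by exact_mod_cast hd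
  -- With s = ⟪u,x⟫ in [-‖x‖, 1], this choice of v turns the right side into s² + (‖x‖ - 1)s = ‖x‖ -
  -- (1 - s)(s + ‖x‖) ≤ ‖x‖.
  obtain ⟨u, hu, hu1, h⟩ := hV.exists_contact hd ((innerSL ℝ x).smulRight x) ((‖x‖ - 1) • x)
  have htr : LinearMap.trace ℝ _ (((innerSL ℝ x).smulRight x :
      EuclideanSpace ℝ (Fin d) →L[ℝ] EuclideanSpace ℝ (Fin d)) :
      EuclideanSpace ℝ (Fin d) →ₗ[ℝ] EuclideanSpace ℝ (Fin d)) = ‖x‖ ^ 2 := by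
    rw [← real_inner_self_eq_norm_sq]
    exact LinearMap.trace_smulRight (innerSL ℝ x : EuclideanSpace ℝ (Fin d) →ₗ[ℝ] ℝ) x
  rw [htr] at h
  simp only [ContinuousLinearMap.smulRight_apply, innerSL_apply_apply, inner_smul_right] at h
  rw [real_inner_comm] at h
  have h1 := hx u hu
  have h2 : -‖x‖ ≤ ⟪u, x⟫_ℝ := by
    have := abs_real_inner_le_norm u x
    rw [hu1, one_mul] at this
    exact (abs_le.1 this).1
  have h3 : ‖x‖ ^ 2 / d ≤ ‖x‖ := by nlinarith
  rw [div_le_iff₀ hd'] at h3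
  by_contra hlt
  push Not at hlt
  nlinarith

end IsJohnPosition

/-! ### Dvoretzky–Rogers and the determinant-maximal tuple. -/

theorem EuclideanSpace.mul_transpose_apply {m n d : ℕ} (u : Fin m → EuclideanSpace ℝ (Fin d))
    (e : Fin n → EuclideanSpace ℝ (Fin d)) (i : Fin m) (j : Fin n) :
    ((Matrix.of fun i k => u i k) * (Matrix.of fun i k => e i k).transpose) i j =
      ⟪e j, u i⟫_ℝ := by
  simp [Matrix.mul_apply, PiLp.inner_apply]

theorem trace_one_sub_sum_orthonormal {d k : ℕ} {e : Fin k → EuclideanSpace ℝ (Fin d)}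
    (he : Orthonormal ℝ e) :
    LinearMap.trace ℝ _ ((ContinuousLinearMap.id ℝ (EuclideanSpace ℝ (Fin d)) -
      ∑ i, (innerSL ℝ (e i)).smulRight (e i) : EuclideanSpace ℝ (Fin d) →L[ℝ]
        EuclideanSpace ℝ (Fin d)) : EuclideanSpace ℝ (Fin d) →ₗ[ℝ] EuclideanSpace ℝ (Fin d)) =
      d - k := by
  rw [ContinuousLinearMap.toLinearMap_sub, map_sub, ContinuousLinearMap.coe_id, LinearMap.trace_id,
    finrank_euclideanSpace_fin, ContinuousLinearMap.toLinearMap_sum, map_sum]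
  simp [he.1]

namespace IsJohnPosition

variable {d : ℕ} {V : Set (EuclideanSpace ℝ (Fin d))}

/-- Dvoretzky–Rogers: greedy choice of contact points that are far from being dependent. -/
theorem exists_orthonormal_triangular (hV : IsJohnPosition V) (hd : 0 < d) :
    ∀ k ≤ d, ∃ e u : Fin k → EuclideanSpace ℝ (Fin d), Orthonormal ℝ e ∧ (∀ i, u i ∈ V) ∧
      (∀ x, (∀ i, ⟪x, e i⟫_ℝ = 0) → ∀ i, ⟪x, u i⟫_ℝ = 0) ∧
      (∀ i j, i < j → ⟪e j, u i⟫_ℝ = 0) ∧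
      ∀ i : Fin k, ((d : ℝ) - (i : ℕ)) / d ≤ ⟪e i, u i⟫_ℝ ^ 2 := by
  intro k
  have hd' : (0 : ℝ) < d := by exact_mod_cast hd
  induction k with
  | zero =>
    exact fun _ => ⟨fun i => i.elim0, fun i => i.elim0, ⟨fun i => i.elim0, fun i => i.elim0⟩,
      fun i => i.elim0, fun _ _ i => i.elim0, fun i => i.elim0, fun i => i.elim0⟩
  | succ k ih =>
    intro hk
    -- `hspan` says that each u i lies in the span of e; this makes the next basis vector orthogonal
    -- to all earlier u i.
    obtain ⟨e, u, he, huV, hspan, htri, hdiag⟩ := ih (by omega)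
    -- H is the projection off the span of e, of trace d - k, so the component r of w outside that
    -- span satisfies ‖r‖² ≥ (d - k)/d.
    obtain ⟨w, hwV, hw1, hw⟩ := hV.exists_contact hd
      (ContinuousLinearMap.id ℝ _ - ∑ i, (innerSL ℝ (e i)).smulRight (e i)) 0
    rw [trace_one_sub_sum_orthonormal he, inner_zero_right, add_zero] at hw
    set r := w - ∑ i, ⟪e i, w⟫_ℝ • e i
    have hHw : (ContinuousLinearMap.id ℝ (EuclideanSpace ℝ (Fin d)) -
        ∑ i, (innerSL ℝ (e i)).smulRight (e i)) w = r := by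
      simp [r, sum_apply]
    rw [hHw] at hw
    have hre : ∀ i, ⟪e i, r⟫_ℝ = 0 := fun i => by
      simp only [r, inner_sub_right]
      rw [he.inner_right_fintype, sub_self]
    have hwr : w = r + ∑ i, ⟪e i, w⟫_ℝ • e i := by simp [r]
    have hrw : ⟪w, r⟫_ℝ = ‖r‖ ^ 2 := by
      nth_rewrite 1 [hwr]
      rw [inner_add_left, sum_inner, real_inner_self_eq_norm_sq]
      simp [inner_smul_left, hre]
    rw [hrw] at hw
    have hkd : (k : ℝ) + 1 ≤ d := by exact_mod_cast hk
    have hr0 : 0 < ‖r‖ := by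
      have : 0 < ((d : ℝ) - k) / d := div_pos (by linarith) hd'
      have h2 : 0 < ‖r‖ ^ 2 := by linarith
      exact lt_of_le_of_ne (norm_nonneg _) fun h => by simp [← h] at h2
    set f := ‖r‖⁻¹ • r
    have hef : ∀ i, ⟪e i, f⟫_ℝ = 0 := fun i => by simp [f, inner_smul_right, hre]
    have hfw : ⟪f, w⟫_ℝ = ‖r‖ := by
      rw [real_inner_comm]
      simp only [f, inner_smul_right, hrw]
      field_simp
    refine ⟨Fin.snoc e f, Fin.snoc u w, ⟨?_, ?_⟩, ?_, ?_, ?_, ?_⟩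
    · intro i
      refine Fin.lastCases ?_ (fun i => ?_) i
      · simp only [Fin.snoc_last, f, norm_smul, norm_inv, norm_norm]
        field_simp
      · simpa using he.1 i
    · intro i j hij
      induction i using Fin.lastCases with
      | last =>
        induction j using Fin.lastCases with
        | last => exact absurd rfl hij
        | cast j => simpa [real_inner_comm] using hef j
      | cast i =>
        induction j using Fin.lastCases with
        | last => simpa using hef i
        | cast j => simpa using he.2 fun h => hij (by rw [h])
    · intro i
      refine Fin.lastCases ?_ (fun i => ?_) i
      · simpa using hwV
      · simpa using huV i
    · intro x hx i
      have hxe : ∀ i, ⟪x, e i⟫_ℝ = 0 := fun i => by simpa using hx i.castSucc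
      have hxf : ⟪x, f⟫_ℝ = 0 := by simpa using hx (Fin.last k)
      refine Fin.lastCases ?_ (fun i => ?_) i
      · have hxr : ⟪x, r⟫_ℝ = 0 := by
          have : r = ‖r‖ • f := by simp [f, smul_smul, hr0.ne']
          rw [this, inner_smul_right, hxf, mul_zero]
        simp only [Fin.snoc_last]
        rw [hwr, inner_add_right, hxr, inner_sum]
        simp [inner_smul_right, hxe]
      · simpa using hspan x hxe i
    · intro i j hij
      induction i using Fin.lastCases with
      | last => exact absurd (Fin.le_last j) (not_le.2 hij)
      | cast i =>
        induction j using Fin.lastCases with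
        | last => simpa using hspan f (fun i => by rw [real_inner_comm]; exact hef i) i
        | cast j => simpa using htri i j (by simpa using hij)
    · intro i
      refine Fin.lastCases ?_ (fun i => ?_) i
      · simpa [hfw] using hw
      · simpa using hdiag i

/-- In the basis e the tuple u is lower triangular, so its squared determinant is the product of the
squared diagonal entries. -/
theorem exists_det_sq_ge (hV : IsJohnPosition V) (hd : 0 < d) :
    ∃ u : Fin d → EuclideanSpace ℝ (Fin d), (∀ i, u i ∈ V) ∧
      (d.factorial : ℝ) / (d : ℝ) ^ d ≤ (Matrix.of fun i j => u i j).det ^ 2 := by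
  obtain ⟨e, u, he, huV, -, htri, hdiag⟩ := hV.exists_orthonormal_triangular hd d le_rfl
  refine ⟨u, huV, ?_⟩
  set W : Matrix (Fin d) (Fin d) ℝ := Matrix.of fun i j => u i j
  set O : Matrix (Fin d) (Fin d) ℝ := Matrix.of fun i j => e i j
  have hO : O * O.transpose = 1 := by
    ext i j
    rw [EuclideanSpace.mul_transpose_apply, orthonormal_iff_ite.1 he j i, Matrix.one_apply]
    simp [eq_comm]
  have hO2 : O.det ^ 2 = 1 := by
    have := congrArg Matrix.det hO
    rw [Matrix.det_mul, Matrix.det_transpose, Matrix.det_one] at this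
    rw [sq, this]
  have hWO : (W * O.transpose).det = ∏ i, ⟪e i, u i⟫_ℝ := by
    rw [Matrix.det_of_isLowerTriangular]
    · exact Finset.prod_congr rfl fun i _ => EuclideanSpace.mul_transpose_apply u e i i
    · intro i j hij
      rw [EuclideanSpace.mul_transpose_apply]
      exact htri i j hij
  have hW : W.det ^ 2 = ∏ i, ⟪e i, u i⟫_ℝ ^ 2 := by
    rw [Finset.prod_pow, ← hWO, Matrix.det_mul, Matrix.det_transpose, mul_pow, hO2, mul_one]
  have hfac : (d.factorial : ℝ) / (d : ℝ) ^ d = ∏ i : Fin d, ((d : ℝ) - (i : ℕ)) / d := by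
    rw [Finset.prod_div_distrib, Finset.prod_const, Finset.card_fin,
      Fin.prod_univ_eq_prod_range (fun i => (d : ℝ) - (i : ℕ)) d,
      ← Nat.descFactorial_self, Nat.descFactorial_eq_prod_range, Nat.cast_prod]
    congr 1
    refine Finset.prod_congr rfl fun i hi => ?_
    rw [Nat.cast_sub (Finset.mem_range.1 hi).le]
  rw [hW, hfac]
  refine Finset.prod_le_prod (fun i _ => div_nonneg ?_ d.cast_nonneg) fun i _ => hdiag i
  have : ((i : ℕ) : ℝ) ≤ d := by exact_mod_cast i.2.le
  linarith

/-- A tuple of points of `V` with maximal determinant. -/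
theorem exists_maximal_det (hV : IsJohnPosition V) (hd : 0 < d) :
    ∃ w : Fin d → EuclideanSpace ℝ (Fin d), (∀ i, w i ∈ V) ∧
      (d.factorial : ℝ) / (d : ℝ) ^ d ≤ (Matrix.of fun i j => w i j).det ^ 2 ∧
      ∀ q ∈ V, ∃ l : Fin d → ℝ, (∀ i, |l i| ≤ 1) ∧ q = ∑ i, l i • w i := by
  obtain ⟨u, hu, hdet⟩ := hV.exists_det_sq_ge hd
  have hcomp : IsCompact (Set.univ.pi fun _ : Fin d => V) := isCompact_univ_pi fun _ => hV.isCompact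
  have hcont : Continuous fun w : Fin d → EuclideanSpace ℝ (Fin d) =>
      (Matrix.of fun i j => w i j).det ^ 2 := by
    refine (Continuous.matrix_det ?_).pow 2
    fun_prop
  obtain ⟨w, hwV, hmax⟩ := hcomp.exists_isMaxOn ⟨u, fun i _ => hu i⟩ hcont.continuousOn
  have hwdet := hdet.trans (hmax fun i _ => hu i : _ ≤ (Matrix.of fun i j => w i j).det ^ 2)
  refine ⟨w, fun i => hwV i trivial, hwdet, fun q hq => ?_⟩
  set W : Matrix (Fin d) (Fin d) ℝ := Matrix.of fun i j => w i j
  have hW0 : 0 < W.det ^ 2 := lt_of_lt_of_le (by positivity) hwdet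
  have hunit : IsUnit W.det := isUnit_iff_ne_zero.2 fun h => by simp [h] at hW0
  set l : Fin d → ℝ := Matrix.vecMul (fun j => q j) W⁻¹
  have hl : (fun j => q j) = ∑ i, l i • W i := by
    have : Matrix.vecMul l W = fun j => q j := by
      simp [l, Matrix.vecMul_vecMul, Matrix.nonsing_inv_mul W hunit]
    rw [← this]
    ext j
    simp [Matrix.vecMul, dotProduct]
  refine ⟨l, fun i => ?_, ?_⟩
  -- Cramer's rule: replacing w i by q multiplies the determinant by l i, so maximality forces |l i|
  -- ≤ 1.
  · have h1 : (W.updateRow i fun j => q j).det = l i * W.det := by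
      rw [hl, Matrix.det_updateRow_sum, smul_eq_mul]
    have h2 : (W.updateRow i fun j => q j) = Matrix.of fun k j => (Function.update w i q) k j := by
      ext k j
      by_cases hk : k = i
      · subst hk; simp
      · simp [hk, W]
    have h3 : (W.updateRow i fun j => q j).det ^ 2 ≤ W.det ^ 2 := by
      rw [h2]
      refine hmax fun k _ => ?_
      by_cases hk : k = i
      · subst hk; simpa using hq
      · simpa [hk] using hwV k trivial
    rw [h1, mul_pow] at h3
    have h4 : l i ^ 2 ≤ 1 := le_of_mul_le_mul_right (by simpa using h3) hW0
    exact abs_le_one_iff_mul_self_le_one.2 (by nlinarith)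
  · ext j
    have := congrFun hl j
    simpa [W] using this

end IsJohnPosition

/-! ### Carathéodory's theorem with the origin as a free vertex. -/

section Caratheodory

variable {E : Type*} [AddCommGroup E] [Module ℝ E]

/-- One step of Carathéodory's reduction, with total weight at most one. -/
theorem exists_erase_sum_smul_eq [DecidableEq E] [FiniteDimensional ℝ E] {s : Finset E} {c : E → ℝ}
    (hs : Module.finrank ℝ E < s.card) (hc : ∀ x ∈ s, 0 ≤ c x) :
    ∃ x ∈ s, ∃ c' : E → ℝ, (∀ y ∈ s.erase x, 0 ≤ c' y) ∧
      ∑ y ∈ s.erase x, c' y ≤ ∑ y ∈ s, c y ∧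
      ∑ y ∈ s.erase x, c' y • y = ∑ y ∈ s, c y • y := by
  obtain ⟨f, hf0, hfsum, hfpos⟩ : ∃ f : E → ℝ, ∑ y ∈ s, f y • y = 0 ∧ 0 ≤ ∑ y ∈ s, f y ∧
      ∃ x ∈ s, 0 < f x := by
    obtain ⟨g, hg, x, hx, hgx⟩ := Module.exists_nontrivial_relation_of_finrank_lt_card (R := ℝ) hs
    have aux : ∀ f : E → ℝ, 0 ≤ ∑ y ∈ s, f y → f x ≠ 0 → ∃ x ∈ s, 0 < f x := by
      intro f hf hfx
      by_contra! hcon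
      have := Finset.sum_lt_sum hcon ⟨x, hx, lt_of_le_of_ne (hcon x hx) hfx⟩
      simp only [Finset.sum_const_zero] at this
      linarith
    -- A linear relation, unlike an affine one, need not have coefficient sum 0. Taking the sign
    -- with non-negative sum ensures that subtracting it never raises the total weight.
    rcases le_total 0 (∑ y ∈ s, g y) with h | h
    · exact ⟨g, hg, h, aux g h hgx⟩
    · refine ⟨-g, by simp [hg], by simpa using h, aux (-g) (by simpa using h) (by simpa using hgx)⟩
  obtain ⟨x, hx, hmin⟩ := Finset.exists_min_image (s.filter fun y => 0 < f y) (fun y => c y / f y)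
    (hfpos.imp fun x hx => Finset.mem_filter.2 hx)
  obtain ⟨hxs, hfx⟩ := Finset.mem_filter.1 hx
  set τ := c x / f x
  have hτ : 0 ≤ τ := div_nonneg (hc x hxs) hfx.le
  have hx0 : c x - τ * f x = 0 := by simp only [τ]; field_simp; ring
  refine ⟨x, hxs, fun y => c y - τ * f y, fun y hy => ?_, ?_, ?_⟩
  · have hys := Finset.mem_of_mem_erase hy
    rcases lt_or_ge 0 (f y) with h | h
    · have := hmin y (Finset.mem_filter.2 ⟨hys, h⟩)
      rw [le_div_iff₀ h] at this
      linarith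
    · have := hc y hys
      nlinarith
  · rw [Finset.sum_erase s (f := fun y => c y - τ * f y) hx0, Finset.sum_sub_distrib,
      ← Finset.mul_sum]
    nlinarith
  · rw [Finset.sum_erase s (f := fun y => (c y - τ * f y) • y)
      (show (c x - τ * f x) • x = 0 by rw [hx0, zero_smul])]
    simp only [sub_smul, Finset.sum_sub_distrib, mul_smul, ← Finset.smul_sum, hf0, smul_zero,
      sub_zero]

/-- Relaxing the total weight from 1 to at most 1 saves one point over the usual dimension plus one;
this is what makes 2d sets suffice. -/
theorem exists_finset_card_le_finrank_of_mem_convexHull [FiniteDimensional ℝ E] {V : Set E} {p : E}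
    (hp : p ∈ convexHull ℝ V) :
    ∃ (s : Finset E) (c : E → ℝ), ↑s ⊆ V ∧ s.card ≤ Module.finrank ℝ E ∧ (∀ x ∈ s, 0 ≤ c x) ∧
      ∑ x ∈ s, c x ≤ 1 ∧ ∑ x ∈ s, c x • x = p := by
  classical
  have key : ∀ (n : ℕ) (s : Finset E) (c : E → ℝ), s.card = n → ↑s ⊆ V → (∀ x ∈ s, 0 ≤ c x) →
      ∑ x ∈ s, c x ≤ 1 → ∑ x ∈ s, c x • x = p →
      ∃ (s : Finset E) (c : E → ℝ), ↑s ⊆ V ∧ s.card ≤ Module.finrank ℝ E ∧ (∀ x ∈ s, 0 ≤ c x) ∧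
        ∑ x ∈ s, c x ≤ 1 ∧ ∑ x ∈ s, c x • x = p := by
    intro n
    induction n with
    | zero => exact fun s c hs hV h0 h1 hp => ⟨s, c, hV, by omega, h0, h1, hp⟩
    | succ n ih =>
      intro s c hs hV h0 h1 hp
      rcases le_or_gt s.card (Module.finrank ℝ E) with h | h
      · exact ⟨s, c, hV, h, h0, h1, hp⟩
      · obtain ⟨x, hx, c', h0', h1', hp'⟩ := exists_erase_sum_smul_eq h h0
        refine ih (s.erase x) c' ?_ ?_ h0' (h1'.trans h1) (hp'.trans hp)
        · rw [Finset.card_erase_of_mem hx, hs, Nat.add_sub_cancel]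
        · exact fun y hy => hV (Finset.mem_of_mem_erase hy)
  rw [convexHull_eq_union] at hp
  simp only [Set.mem_iUnion] at hp
  obtain ⟨s, hs, -, hp⟩ := hp
  obtain ⟨c, h0, h1, hp⟩ := Finset.mem_convexHull'.1 hp
  exact key _ s c rfl hs h0 h1.le hp

end Caratheodory

/-- Combinations of at most `d` points with nonnegative weights of sum at most one. -/
def shortCombinations {d : ℕ} (V : Set (EuclideanSpace ℝ (Fin d))) :
    Set (EuclideanSpace ℝ (Fin d)) :=
  (fun q : (Fin d → EuclideanSpace ℝ (Fin d)) × (Fin d → ℝ) => ∑ i, q.2 i • q.1 i) ''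
    ((Set.univ.pi fun _ => V) ×ˢ {a | (∀ i, 0 ≤ a i) ∧ ∑ i, a i ≤ 1})

theorem isCompact_shortCombinations {d : ℕ} {V : Set (EuclideanSpace ℝ (Fin d))}
    (hV : IsCompact V) : IsCompact (shortCombinations V) := by
  refine ((isCompact_univ_pi fun _ => hV).prod ?_).image (by fun_prop)
  refine Metric.isCompact_of_isClosed_isBounded ?_ ?_
  · refine IsClosed.inter (s₁ := {a : Fin d → ℝ | ∀ i, 0 ≤ a i}) ?_ ?_
    · simp only [Set.ofPred_forall]
      exact isClosed_iInter fun i => isClosed_le continuous_const (continuous_apply i)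
    · exact isClosed_le (continuous_finsetSum _ fun i _ => continuous_apply i) continuous_const
  · refine (Metric.isBounded_Icc (0 : Fin d → ℝ) 1).subset fun a ha => ⟨ha.1, fun i => ?_⟩
    exact (Finset.single_le_sum (fun j _ => ha.1 j) (Finset.mem_univ i)).trans ha.2

theorem convexHull_subset_shortCombinations {d : ℕ} {V : Set (EuclideanSpace ℝ (Fin d))} :
    convexHull ℝ V ⊆ shortCombinations V := by
  intro p hp
  obtain ⟨x₀, hx₀⟩ := convexHull_nonempty_iff.1 ⟨p, hp⟩
  obtain ⟨s, c, hs, hcard, h0, h1, hsum⟩ := exists_finset_card_le_finrank_of_mem_convexHull hp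
  rw [finrank_euclideanSpace_fin] at hcard
  obtain ⟨g⟩ : Nonempty (s ↪ Fin d) := Function.Embedding.nonempty_of_card_le (by simpa using hcard)
  set v := Function.extend g (fun x : s => (x : EuclideanSpace ℝ (Fin d))) fun _ => x₀
  set a := Function.extend g (fun x : s => c x) fun _ => 0
  have hv : ∀ x, v (g x) = x := fun x => g.injective.extend_apply _ _ x
  have ha : ∀ x, a (g x) = c x := fun x => g.injective.extend_apply _ _ x
  have ha' : ∀ i, i ∉ Set.range g → a i = 0 := fun i hi => Function.extend_apply' _ _ _ hi
  refine ⟨(v, a), ⟨fun i _ => ?_, fun i => ?_, ?_⟩, ?_⟩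
  · by_cases hi : i ∈ Set.range g
    · obtain ⟨x, rfl⟩ := hi
      simpa [hv] using hs x.2
    · simpa [v, Function.extend_apply' _ _ _ hi] using hx₀
  · by_cases hi : i ∈ Set.range g
    · obtain ⟨x, rfl⟩ := hi
      simpa [ha] using h0 x x.2
    · exact (ha' i hi).ge
  · change ∑ i, a i ≤ 1
    rw [← Fintype.sum_of_injective g g.injective (fun x : s => c x) a ha' fun x => (ha x).symm]
    rwa [Finset.sum_coe_sort s c]
  · change ∑ i, a i • v i = p
    rw [← Fintype.sum_of_injective g g.injective
      (fun x : s => c x • (x : EuclideanSpace ℝ (Fin d))) (fun i => a i • v i)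
      (fun i hi => by simp [ha' i hi]) fun x => by simp [hv, ha]]
    rw [← hsum, Finset.sum_coe_sort s fun x => c x • x]

/-! ### Selecting 2d constraints. -/

namespace IsJohnPosition

variable {d : ℕ} {V : Set (EuclideanSpace ℝ (Fin d))}

/-- The short combinations form a compact set containing the closed hull. A functional x separating
the point from the hull at level s would have x/s in the polar of V, so ‖x‖ ≤ sd and ⟪w i,x⟫ ≥ -sd,
which puts its value at the point at most s. -/
theorem neg_sum_mem_shortCombinations (hV : IsJohnPosition V) (hd : 0 < d)
    {w : Fin d → EuclideanSpace ℝ (Fin d)} (hw : ∀ i, w i ∈ V) :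
    -(((d : ℝ) ^ 2)⁻¹ • ∑ i, w i) ∈ shortCombinations V := by
  have hd' : (0 : ℝ) < d := by exact_mod_cast hd
  by_contra hcon
  have hcl : closure (convexHull ℝ V) ⊆ shortCombinations V :=
    closure_minimal convexHull_subset_shortCombinations
      (isCompact_shortCombinations hV.isCompact).isClosed
  obtain ⟨f, s, hfs, hsf⟩ := geometric_hahn_banach_closed_point (convex_convexHull ℝ V).closure
    isClosed_closure fun h => hcon (hcl h)
  set x := (InnerProductSpace.toDual ℝ (EuclideanSpace ℝ (Fin d))).symm f
  have hfx : ∀ y, f y = ⟪y, x⟫_ℝ := fun y => by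
    rw [real_inner_comm]; exact (InnerProductSpace.toDual_symm_apply (𝕜 := ℝ)).symm
  have hVs : ∀ y ∈ V, ⟪y, x⟫_ℝ < s := fun y hy => by
    rw [← hfx]; exact hfs y (subset_closure (subset_convexHull ℝ V hy))
  -- With H = 0, some contact point has ⟪u,x⟫ ≥ 0, so the separating level s is positive.
  obtain ⟨u, hu, -, hux⟩ := hV.exists_contact hd 0 x
  have hs : 0 < s := by
    have := hVs u hu
    simp at hux
    linarith
  have hnorm : ‖s⁻¹ • x‖ ≤ d := hV.norm_le_of_mem_polar hd fun y hy => by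
    rw [inner_smul_right, inv_mul_le_iff₀ hs]
    linarith [hVs y hy]
  rw [norm_smul, Real.norm_of_nonneg (inv_pos.2 hs).le, inv_mul_le_iff₀ hs] at hnorm
  rw [hfx, inner_neg_left, inner_smul_left, sum_inner] at hsf
  simp only [conj_trivial] at hsf
  have hlow : ∀ i, -(s * d) ≤ ⟪w i, x⟫_ℝ := fun i => by
    have h1 := (abs_le.1 (abs_real_inner_le_norm (w i) x)).1
    have h2 : ‖w i‖ * ‖x‖ ≤ 1 * (s * d) :=
      mul_le_mul (hV.norm_le _ (hw i)) hnorm (norm_nonneg _) zero_le_one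
    linarith
  have hsum : -(s * d) * d ≤ ∑ i, ⟪w i, x⟫_ℝ := by
    calc -(s * d) * d = ∑ _i : Fin d, -(s * d) := by simp; ring
      _ ≤ _ := Finset.sum_le_sum fun i _ => hlow i
  have : ((d : ℝ) ^ 2)⁻¹ * (-(s * d) * d) ≤ ((d : ℝ) ^ 2)⁻¹ * ∑ i, ⟪w i, x⟫_ℝ := by gcongr
  have h2 : ((d : ℝ) ^ 2)⁻¹ * (-(s * d) * d) = -s := by field_simp
  linarith

theorem exists_selection (hV : IsJohnPosition V) (hd : 0 < d) :
    ∃ w v : Fin d → EuclideanSpace ℝ (Fin d), (∀ i, w i ∈ V) ∧ (∀ i, v i ∈ V) ∧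
      (d.factorial : ℝ) / (d : ℝ) ^ d ≤ (Matrix.of fun i j => w i j).det ^ 2 ∧
      ∀ x, (∀ i, ⟪w i, x⟫_ℝ ≤ 1) → (∀ i, ⟪v i, x⟫_ℝ ≤ 1) →
        -((d : ℝ) ^ 2) ≤ ∑ i, ⟪w i, x⟫_ℝ ∧ ∀ y ∈ V, -⟪y, x⟫_ℝ ≤ d * (d + 2) := by
  have hd' : (0 : ℝ) < d := by exact_mod_cast hd
  obtain ⟨w, hw, hdet, hrep⟩ := hV.exists_maximal_det hd
  obtain ⟨⟨v, a⟩, ⟨hv, ha0, ha1⟩, hva⟩ := hV.neg_sum_mem_shortCombinations hd hw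
  refine ⟨w, v, hw, fun i => hv i trivial, hdet, fun x hwx hvx => ?_⟩
  have hlow : -((d : ℝ) ^ 2) ≤ ∑ i, ⟪w i, x⟫_ℝ := by
    have h1 : ⟪∑ i, a i • v i, x⟫_ℝ ≤ 1 := by
      rw [sum_inner]
      refine le_trans (Finset.sum_le_sum fun i _ => ?_) ha1
      rw [inner_smul_left, conj_trivial]
      exact mul_le_of_le_one_right (ha0 i) (hvx i)
    rw [show ∑ i, a i • v i = _ from hva, inner_neg_left, inner_smul_left, sum_inner,
      conj_trivial] at h1
    have h2 : -1 ≤ ((d : ℝ) ^ 2)⁻¹ * ∑ i, ⟪w i, x⟫_ℝ := by linarith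
    rw [le_inv_mul_iff₀ (by positivity)] at h2
    linarith
  refine ⟨hlow, fun y hy => ?_⟩
  obtain ⟨l, hl, rfl⟩ := hrep y hy
  rw [sum_inner, ← Finset.sum_neg_distrib]
  -- With t = ⟪w i,x⟫ ≤ 1 and |l i| ≤ 1, (1 - l i)t ≤ 1 - l i ≤ 2.
  calc ∑ i, -⟪l i • w i, x⟫_ℝ ≤ ∑ i, (2 - ⟪w i, x⟫_ℝ) := by
        refine Finset.sum_le_sum fun i _ => ?_
        rw [inner_smul_left, conj_trivial]
        obtain ⟨h1, h2⟩ := abs_le.1 (hl i)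
        nlinarith [hwx i]
    _ = d * 2 - ∑ i, ⟪w i, x⟫_ℝ := by simp [Finset.sum_sub_distrib]
    _ ≤ d * (d + 2) := by nlinarith

end IsJohnPosition

/-! ### Volume estimates. -/

theorem volume_l1_ball {d : ℕ} (hd : 0 < d) {R : ℝ} (hR : 0 ≤ R) :
    volume {z : Fin d → ℝ | ∑ i, |z i| ≤ R} = ENNReal.ofReal ((2 * R) ^ d / d.factorial) := by
  have : Nonempty (Fin d) := ⟨⟨0, hd⟩⟩
  have h := MeasureTheory.volume_sum_rpow_le (ι := Fin d) (p := 1) le_rfl R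
  have h2 : Real.Gamma (1 + 1) = 1 := by
    have := Real.Gamma_nat_eq_factorial 1
    simpa using this
  simp only [Real.rpow_one, div_one, Fintype.card_fin, Real.Gamma_nat_eq_factorial, h2,
    mul_one] at h
  rw [h, ← ENNReal.ofReal_pow hR, ← ENNReal.ofReal_mul (by positivity)]
  congr 1
  rw [mul_pow]
  ring

/-- In the coordinates uᵢ = ⟪wᵢ,x⟫ the numbers 1 - uᵢ are non-negative with sum at most d + r, so a
translate of the simplex lies in an ℓ¹ ball. This loses a factor 2^d, harmless here. -/
theorem volume_simplex_le {d : ℕ} (hd : 0 < d) {w : Fin d → EuclideanSpace ℝ (Fin d)}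
    (hw : (Matrix.of fun i j => w i j).det ≠ 0) {r : ℝ} (hr : 0 ≤ r) :
    volume {x : EuclideanSpace ℝ (Fin d) | (∀ i, ⟪w i, x⟫_ℝ ≤ 1) ∧ -r ≤ ∑ i, ⟪w i, x⟫_ℝ} ≤
      ENNReal.ofReal (|(Matrix.of fun i j => w i j).det|⁻¹ *
        ((2 * (d + r)) ^ d / d.factorial)) := by
  set W : Matrix (Fin d) (Fin d) ℝ := Matrix.of fun i j => w i j
  set S : Set (Fin d → ℝ) := {u | (∀ i, u i ≤ 1) ∧ -r ≤ ∑ i, u i}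
  have hinner : ∀ (x : EuclideanSpace ℝ (Fin d)) i, ⟪w i, x⟫_ℝ = Matrix.toLin' W x.ofLp i := by
    intro x i
    simp [W, PiLp.inner_apply, Matrix.mulVec, dotProduct, mul_comm]
  have hset : {x : EuclideanSpace ℝ (Fin d) | (∀ i, ⟪w i, x⟫_ℝ ≤ 1) ∧ -r ≤ ∑ i, ⟪w i, x⟫_ℝ} =
      WithLp.ofLp ⁻¹' (Matrix.toLin' W ⁻¹' S) := by
    ext x
    simp only [Set.mem_ofPred_eq, hinner, S, Set.mem_preimage]
  have hS : volume S ≤ ENNReal.ofReal ((2 * (d + r)) ^ d / d.factorial) := by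
    rw [← volume_l1_ball hd (by positivity),
      ← measure_preimage_add_right volume (-1) {z : Fin d → ℝ | ∑ i, |z i| ≤ d + r}]
    refine measure_mono fun u hu => ?_
    simp only [Set.mem_preimage, Set.mem_ofPred_eq]
    have : ∀ i, |(u + -1) i| = 1 - u i := fun i => by
      rw [abs_of_nonpos] <;> simp <;> linarith [hu.1 i]
    simp only [this, Finset.sum_sub_distrib]
    have := hu.2
    simp
    linarith
  have hdet : LinearMap.det (Matrix.toLin' W) = W.det := LinearMap.det_toLin' W
  have hpre : volume (WithLp.ofLp ⁻¹' (Matrix.toLin' W ⁻¹' S) : Set (EuclideanSpace ℝ (Fin d))) =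
      volume (Matrix.toLin' W ⁻¹' S) :=
    (EuclideanSpace.volume_preserving_symm_measurableEquiv_toLp (Fin d)).measure_preimage_equiv _
  rw [hset, hpre, Measure.addHaar_preimage_linearMap volume (by rwa [hdet]), hdet,
    abs_inv, ENNReal.ofReal_mul (by positivity)]
  gcongr

/-- The ball contains the cube of side 2/√d. -/
theorem volume_closedBall_ge {d : ℕ} (hd : 0 < d) :
    ENNReal.ofReal ((2 / √d) ^ d) ≤
      volume (Metric.closedBall (0 : EuclideanSpace ℝ (Fin d)) 1) := by
  have hd' : (0 : ℝ) < d := by exact_mod_cast hd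
  have h := Real.volume_pi_closedBall (0 : Fin d → ℝ) (r := 1 / √d) (by positivity)
  rw [Fintype.card_fin, mul_one_div] at h
  rw [← h, ← (EuclideanSpace.volume_preserving_symm_measurableEquiv_toLp
    (Fin d)).measure_preimage_equiv]
  refine measure_mono fun x hx => ?_
  have hx' : ∀ i, |x i| ≤ 1 / √d := fun i => by
    have h1 : ‖x.ofLp‖ ≤ 1 / √d := by simpa using hx
    exact (norm_le_pi_norm x.ofLp i).trans h1
  rw [mem_closedBall_zero_iff, EuclideanSpace.norm_eq, Real.sqrt_le_one]
  calc ∑ i, ‖x i‖ ^ 2 ≤ ∑ _i : Fin d, 1 / (d : ℝ) := by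
        refine Finset.sum_le_sum fun i _ => ?_
        calc ‖x i‖ ^ 2 ≤ (1 / √d) ^ 2 := pow_le_pow_left₀ (norm_nonneg _) (hx' i) 2
          _ = 1 / d := by rw [div_pow, Real.sq_sqrt hd'.le, one_pow]
    _ = 1 := by simp [hd'.ne']

/-- From d^d/d! ≤ e^d, and the crude |D|⁻¹ ≤ e^d, the left side is at most (4e²d)^d ≤ (36d)^d. The
right side equals (128d)^d, because 16^{3/2}·2 = 128. -/
theorem simplex_volume_bound {d : ℕ} (hd : 0 < d) {D : ℝ}
    (hD : (d.factorial : ℝ) / (d : ℝ) ^ d ≤ D ^ 2) :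
    |D|⁻¹ * ((2 * (d + (d : ℝ) ^ 2)) ^ d / d.factorial) ≤
      (16 * (d : ℝ)) ^ (3 * (d : ℝ) / 2) * (2 / √d) ^ d := by
  have hd1 : (1 : ℝ) ≤ d := by exact_mod_cast hd
  have hd' : (0 : ℝ) < d := by linarith
  set e := Real.exp 1
  have he0 : 0 < e := Real.exp_pos 1
  have he1 : 1 ≤ e := Real.one_le_exp zero_le_one
  have he3 : e ≤ 3 := Real.exp_one_lt_three.le
  have hfac0 : (0 : ℝ) < d.factorial := by positivity
  have hfac : (d : ℝ) ^ d / d.factorial ≤ e ^ d := by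
    simpa [e, ← Real.exp_nat_mul] using Real.pow_div_factorial_le_exp (d : ℝ) hd'.le d
  have hD1 : |D|⁻¹ ≤ e ^ d := by
    have h1 : (e ^ d)⁻¹ ≤ D ^ 2 := by
      refine le_trans ?_ hD
      rw [← inv_div]
      exact inv_anti₀ (by positivity) hfac
    have h2 : ((e ^ d)⁻¹) ^ 2 ≤ |D| ^ 2 := by
      rw [sq_abs]
      refine le_trans ?_ h1
      rw [sq]
      exact mul_le_of_le_one_left (by positivity) (inv_le_one_of_one_le₀ (one_le_pow₀ he1))
    have h3 := le_of_sq_le_sq h2 (abs_nonneg D)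
    exact inv_le_of_inv_le₀ (by positivity) h3
  have hR : (2 * (d + (d : ℝ) ^ 2)) ^ d ≤ (4 * d) ^ d * (d : ℝ) ^ d := by
    rw [← mul_pow]
    exact pow_le_pow_left₀ (by positivity) (by nlinarith) d
  have hpow : (16 * (d : ℝ)) ^ (3 * (d : ℝ) / 2) * (2 / √d) ^ d = (128 * d) ^ d := by
    have h16 : √(16 * (d : ℝ)) = 4 * √d := by
      rw [Real.sqrt_mul (by norm_num), show (16 : ℝ) = 4 ^ 2 by norm_num,
        Real.sqrt_sq (by norm_num)]
    have h1 : (16 * (d : ℝ)) ^ (3 * (d : ℝ) / 2) = ((4 * √d) ^ 3) ^ d := by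
      rw [← h16, ← pow_mul, ← Real.rpow_natCast, Real.sqrt_eq_rpow, ← Real.rpow_mul (by positivity)]
      congr 1
      push_cast
      ring
    rw [h1, ← mul_pow]
    congr 1
    have hs : √(d : ℝ) ≠ 0 := (Real.sqrt_pos.2 hd').ne'
    have : √(d : ℝ) ^ 2 = d := Real.sq_sqrt hd'.le
    field_simp
    nlinarith
  rw [hpow]
  calc |D|⁻¹ * ((2 * (d + (d : ℝ) ^ 2)) ^ d / d.factorial)
      ≤ e ^ d * ((4 * d) ^ d * (d : ℝ) ^ d / d.factorial) := by gcongr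
    _ = e ^ d * (4 * d) ^ d * ((d : ℝ) ^ d / d.factorial) := by ring
    _ ≤ e ^ d * (4 * d) ^ d * e ^ d := by gcongr
    _ = (e * (4 * d) * e) ^ d := by simp only [mul_pow]
    _ ≤ (128 * d) ^ d := by
      refine pow_le_pow_left₀ (by positivity) ?_ d
      have : e * e ≤ 3 * 3 := mul_le_mul he3 he3 he0.le (by norm_num)
      nlinarith

namespace IsJohnPosition

/-- At most `2 * d` of the constraints defined by `V` cut out a set that is not much larger. -/
theorem exists_selection_volume {d : ℕ} {V : Set (EuclideanSpace ℝ (Fin d))}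
    (hV : IsJohnPosition V) (hd : 0 < d) :
    ∃ w v : Fin d → EuclideanSpace ℝ (Fin d), (∀ i, w i ∈ V) ∧ (∀ i, v i ∈ V) ∧
      (∀ x, (∀ i, ⟪w i, x⟫_ℝ ≤ 1) → (∀ i, ⟪v i, x⟫_ℝ ≤ 1) →
        ∀ y ∈ V, -⟪y, x⟫_ℝ ≤ d * (d + 2)) ∧
      volume {x | (∀ i, ⟪w i, x⟫_ℝ ≤ 1) ∧ ∀ i, ⟪v i, x⟫_ℝ ≤ 1} ≤
        ENNReal.ofReal ((16 * (d : ℝ)) ^ (3 * (d : ℝ) / 2)) *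
          volume (Metric.closedBall (0 : EuclideanSpace ℝ (Fin d)) 1) := by
  have hd' : (0 : ℝ) < d := by exact_mod_cast hd
  obtain ⟨w, v, hw, hv, hdet, h⟩ := hV.exists_selection hd
  refine ⟨w, v, hw, hv, fun x h1 h2 => (h x h1 h2).2, ?_⟩
  have hdet0 : (Matrix.of fun i j => w i j).det ≠ 0 := fun h0 => by
    rw [h0] at hdet
    have : (0 : ℝ) < d.factorial / (d : ℝ) ^ d := by positivity
    norm_num at hdet
    linarith
  calc _ ≤ volume {x | (∀ i, ⟪w i, x⟫_ℝ ≤ 1) ∧ -((d : ℝ) ^ 2) ≤ ∑ i, ⟪w i, x⟫_ℝ} :=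
        measure_mono fun x hx => ⟨hx.1, (h x hx.1 hx.2).1⟩
    _ ≤ _ := volume_simplex_le hd hdet0 (by positivity)
    _ ≤ _ := ENNReal.ofReal_le_ofReal (simplex_volume_bound hd hdet)
    _ = _ := ENNReal.ofReal_mul (by positivity)
    _ ≤ _ := by gcongr; exact volume_closedBall_ge hd

end IsJohnPosition

/-! ### Maximal ellipsoids, polars and the normalized family. -/

/-- Pairs (A, v) whose ellipsoid lies in K form a compact set, on which |det| attains its maximum; a
small ball inside K makes that maximum positive. -/
theorem IsConvexBody.exists_maximal_ellipsoid {d : ℕ} {K : Set (EuclideanSpace ℝ (Fin d))}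
    (hK : IsConvexBody K) :
    ∃ (A : EuclideanSpace ℝ (Fin d) →L[ℝ] EuclideanSpace ℝ (Fin d))
      (v : EuclideanSpace ℝ (Fin d)), A.det ≠ 0 ∧ (∀ z, ‖z‖ ≤ 1 → v + A z ∈ K) ∧
      ∀ (A' : EuclideanSpace ℝ (Fin d) →L[ℝ] EuclideanSpace ℝ (Fin d))
        (v' : EuclideanSpace ℝ (Fin d)), (∀ z, ‖z‖ ≤ 1 → v' + A' z ∈ K) → |A'.det| ≤ |A.det| := by
  obtain ⟨-, hcomp, x₀, hx₀⟩ := hK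
  set Ω : Set ((EuclideanSpace ℝ (Fin d) →L[ℝ] EuclideanSpace ℝ (Fin d)) ×
    EuclideanSpace ℝ (Fin d)) := {q | ∀ z, ‖z‖ ≤ 1 → q.2 + q.1 z ∈ K}
  have hclosed : IsClosed Ω := by
    simp only [Ω, Set.ofPred_forall]
    refine isClosed_iInter fun z => isClosed_iInter fun _ => ?_
    exact hcomp.isClosed.preimage (by fun_prop :
      Continuous fun q : (EuclideanSpace ℝ (Fin d) →L[ℝ] EuclideanSpace ℝ (Fin d)) ×
        EuclideanSpace ℝ (Fin d) => q.2 + q.1 z)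
  obtain ⟨R, hR⟩ := hcomp.isBounded.exists_norm_le
  have hbdd : Bornology.IsBounded Ω := by
    refine isBounded_iff_forall_norm_le.2 ⟨2 * R, fun q hq => ?_⟩
    have hv : ‖q.2‖ ≤ R := by simpa using hR _ (hq 0 (by simp))
    have hR0 : 0 ≤ R := (norm_nonneg _).trans hv
    have hA : ‖q.1‖ ≤ 2 * R := by
      refine ContinuousLinearMap.opNorm_le_of_unit_norm (by positivity) fun z hz => ?_
      have h1 := hR _ (hq z hz.le)
      calc ‖q.1 z‖ = ‖(q.2 + q.1 z) - q.2‖ := by rw [add_sub_cancel_left]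
        _ ≤ ‖q.2 + q.1 z‖ + ‖q.2‖ := norm_sub_le _ _
        _ ≤ 2 * R := by linarith
    exact max_le hA (by linarith)
  obtain ⟨r, hr, hball⟩ := Metric.nhds_basis_closedBall.mem_iff.1 (mem_interior_iff_mem_nhds.1 hx₀)
  have hmem : ((r • ContinuousLinearMap.id ℝ (EuclideanSpace ℝ (Fin d))), x₀) ∈ Ω := fun z hz => by
    apply hball
    simp only [smul_apply, ContinuousLinearMap.id_apply, mem_closedBall_iff_norm,
      add_sub_cancel_left, norm_smul, Real.norm_of_nonneg hr.le]
    exact mul_le_of_le_one_right hr.le hz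
  have hdet : (r • ContinuousLinearMap.id ℝ (EuclideanSpace ℝ (Fin d))).det = r ^ d := by
    simp [ContinuousLinearMap.det, LinearMap.det_smul]
  have hcont : Continuous fun q : (EuclideanSpace ℝ (Fin d) →L[ℝ] EuclideanSpace ℝ (Fin d)) ×
      EuclideanSpace ℝ (Fin d) => |q.1.det| :=
    (ContinuousLinearMap.continuous_det.comp continuous_fst).abs
  obtain ⟨⟨A, v⟩, hAv, hmax⟩ := (Metric.isCompact_of_isClosed_isBounded hclosed hbdd).exists_isMaxOn
    ⟨_, hmem⟩ hcont.continuousOn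
  refine ⟨A, v, fun h0 => ?_, hAv, fun A' v' h => hmax (a := (A', v')) h⟩
  have h1 : |(r • ContinuousLinearMap.id ℝ (EuclideanSpace ℝ (Fin d))).det| ≤ |A.det| := hmax hmem
  rw [h0, hdet, abs_zero] at h1
  have : 0 < |r ^ d| := abs_pos.2 (by positivity)
  linarith

/-- The one-sided polar of a set. -/
def polarSet {d : ℕ} (L : Set (EuclideanSpace ℝ (Fin d))) : Set (EuclideanSpace ℝ (Fin d)) :=
  {y | ∀ x ∈ L, ⟪y, x⟫_ℝ ≤ 1}

theorem norm_le_one_of_mem_polarSet {d : ℕ} {L : Set (EuclideanSpace ℝ (Fin d))}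
    (hL : ∀ z, ‖z‖ ≤ 1 → z ∈ L) {y : EuclideanSpace ℝ (Fin d)} (hy : y ∈ polarSet L) :
    ‖y‖ ≤ 1 := by
  rcases eq_or_ne y 0 with rfl | hne
  · simp
  have hpos : 0 < ‖y‖ := norm_pos_iff.2 hne
  have h := hy (‖y‖⁻¹ • y) (hL _ (by rw [norm_smul, norm_inv, norm_norm, inv_mul_cancel₀ hpos.ne']))
  rw [inner_smul_right, real_inner_self_eq_norm_sq] at h
  field_simp at h
  exact h

theorem isCompact_polarSet {d : ℕ} {L : Set (EuclideanSpace ℝ (Fin d))}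
    (hL : ∀ z, ‖z‖ ≤ 1 → z ∈ L) : IsCompact (polarSet L) := by
  refine Metric.isCompact_of_isClosed_isBounded ?_ ?_
  · simp only [polarSet, Set.ofPred_forall]
    exact isClosed_iInter fun x => isClosed_iInter fun _ =>
      isClosed_le (by fun_prop) continuous_const
  · exact isBounded_iff_forall_norm_le.2 ⟨1, fun y hy => norm_le_one_of_mem_polarSet hL hy⟩

theorem mem_of_forall_polarSet {d : ℕ} {L : Set (EuclideanSpace ℝ (Fin d))} (hc : IsClosed L)
    (hconv : Convex ℝ L) (h0 : 0 ∈ L) {x : EuclideanSpace ℝ (Fin d)}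
    (hx : ∀ y ∈ polarSet L, ⟪y, x⟫_ℝ ≤ 1) : x ∈ L := by
  by_contra hcon
  obtain ⟨f, s, hfs, hsf⟩ := geometric_hahn_banach_closed_point hconv hc hcon
  have hs : 0 < s := by simpa using hfs 0 h0
  set y := (InnerProductSpace.toDual ℝ (EuclideanSpace ℝ (Fin d))).symm f
  have hfy : ∀ z, f z = ⟪y, z⟫_ℝ := fun z =>
    (InnerProductSpace.toDual_symm_apply (𝕜 := ℝ)).symm
  have hin : ∀ z, ⟪s⁻¹ • y, z⟫_ℝ = s⁻¹ * f z := fun z => by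
    rw [inner_smul_left, conj_trivial, hfy]
  have := hx (s⁻¹ • y) fun z hz => by
    rw [hin, inv_mul_le_iff₀ hs]
    linarith [hfs z hz]
  rw [hin, inv_mul_le_iff₀ hs] at this
  linarith

theorem exists_subfamily_of_maximal_ball {d : ℕ} (hd : 0 < d) {ι : Type*} [Finite ι]
    {L : ι → Set (EuclideanSpace ℝ (Fin d))} (hc : ∀ i, IsClosed (L i))
    (hconv : ∀ i, Convex ℝ (L i)) (hball : ∀ i z, ‖z‖ ≤ 1 → z ∈ L i)
    (hmax : ∀ (A : EuclideanSpace ℝ (Fin d) →L[ℝ] EuclideanSpace ℝ (Fin d))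
      (v : EuclideanSpace ℝ (Fin d)), (∀ z, ‖z‖ ≤ 1 → ∀ i, v + A z ∈ L i) → |A.det| ≤ 1) :
    ∃ σ : Finset ι, σ.card ≤ 2 * d ∧
      (∀ x ∈ ⋂ i ∈ σ, L i, -(((d : ℝ) * (d + 2))⁻¹ • x) ∈ ⋂ i, L i) ∧
      volume (⋂ i ∈ σ, L i) ≤ ENNReal.ofReal ((16 * (d : ℝ)) ^ (3 * (d : ℝ) / 2)) *
        volume (⋂ i, L i) := by
  classical
  have h0 : ∀ i, (0 : EuclideanSpace ℝ (Fin d)) ∈ L i := fun i => hball i 0 (by simp)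
  -- The union of the polars, not the polar of the intersection: every point of it belongs to a
  -- definite index i.
  have hV : IsJohnPosition (⋃ i, polarSet (L i)) := by
    refine ⟨isCompact_iUnion fun i => isCompact_polarSet (hball i), fun y hy => ?_,
      fun A v h => hmax A v fun z hz i => ?_⟩
    · obtain ⟨i, hi⟩ := Set.mem_iUnion.1 hy
      exact norm_le_one_of_mem_polarSet (hball i) hi
    · exact mem_of_forall_polarSet (hc i) (hconv i) (h0 i) fun y hy =>
        h z hz y (Set.mem_iUnion.2 ⟨i, hy⟩)
  obtain ⟨w, v, hw, hv, hincl, hvol⟩ := hV.exists_selection_volume hd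
  choose a ha using fun i => Set.mem_iUnion.1 (hw i)
  choose b hb using fun i => Set.mem_iUnion.1 (hv i)
  set σ := Finset.univ.image a ∪ Finset.univ.image b
  have hσ : ∀ x ∈ ⋂ i ∈ σ, L i, (∀ i, ⟪w i, x⟫_ℝ ≤ 1) ∧ ∀ i, ⟪v i, x⟫_ℝ ≤ 1 := fun x hx => by
    rw [Set.mem_iInter₂] at hx
    exact ⟨fun i => ha i x (hx _ (by simp [σ])), fun i => hb i x (hx _ (by simp [σ]))⟩
  refine ⟨σ, ?_, fun x hx => Set.mem_iInter.2 fun i => ?_, ?_⟩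
  · calc σ.card ≤ (Finset.univ.image a).card + (Finset.univ.image b).card :=
          Finset.card_union_le _ _
      _ ≤ d + d := by
          gcongr <;> exact Finset.card_image_le.trans (by simp)
      _ = 2 * d := by ring
  · refine mem_of_forall_polarSet (hc i) (hconv i) (h0 i) fun y hy => ?_
    rw [inner_neg_right, inner_smul_right, ← mul_neg, inv_mul_le_iff₀ (by positivity), mul_one]
    exact hincl x (hσ x hx).1 (hσ x hx).2 y (Set.mem_iUnion.2 ⟨i, hy⟩)
  · refine (measure_mono hσ).trans (hvol.trans ?_)
    gcongr
    exact fun z hz => Set.mem_iInter.2 fun i => hball i z (mem_closedBall_zero_iff.1 hz)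

/-! ### Undoing the normalization. -/

theorem volume_preimage_affine {d : ℕ}
    {A : EuclideanSpace ℝ (Fin d) →L[ℝ] EuclideanSpace ℝ (Fin d)} (hA : A.det ≠ 0)
    (v : EuclideanSpace ℝ (Fin d)) (S : Set (EuclideanSpace ℝ (Fin d))) :
    volume ((fun z => v + A z) ⁻¹' S) = ENNReal.ofReal |A.det⁻¹| * volume S := by
  have : (fun z => v + A z) ⁻¹' S = A ⁻¹' ((fun z => v + z) ⁻¹' S) := rfl
  rw [this, Measure.addHaar_preimage_continuousLinearMap volume hA, measure_preimage_add]

/-- Quantitative Helly theorem for finitely many closed convex sets whose intersection is a convex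
body. -/
theorem exists_subfamily_volume_ediam {d : ℕ} (hd : 2 ≤ d) {ι : Type*} [Finite ι]
    {K : ι → Set (EuclideanSpace ℝ (Fin d))} (hc : ∀ i, IsClosed (K i))
    (hconv : ∀ i, Convex ℝ (K i)) (hK : IsConvexBody (⋂ i, K i)) :
    ∃ σ : Finset ι, σ.card ≤ 2 * d ∧
      volume (⋂ i ∈ σ, K i) ≤ ENNReal.ofReal ((16 * (d : ℝ)) ^ (3 * (d : ℝ) / 2)) *
        volume (⋂ i, K i) ∧
      Metric.ediam (⋂ i ∈ σ, K i) ≤ 2 * (d : ℝ≥0∞) ^ 2 * Metric.ediam (⋂ i, K i) := by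
  obtain ⟨A, v, hdet, hball, hmax⟩ := hK.exists_maximal_ellipsoid
  set φ : EuclideanSpace ℝ (Fin d) → EuclideanSpace ℝ (Fin d) := fun z => v + A z
  have hφc : Continuous φ := by fun_prop
  have hsurj : Function.Surjective φ := fun x => by
    obtain ⟨z, hz⟩ := (LinearMap.equivOfDetNeZero (A : EuclideanSpace ℝ (Fin d) →ₗ[ℝ]
      EuclideanSpace ℝ (Fin d)) hdet).surjective (x - v)
    refine ⟨z, ?_⟩
    have : A z = x - v := hz
    simp [φ, this]
  obtain ⟨σ, hcard, hincl, hvol⟩ := exists_subfamily_of_maximal_ball (by omega : 0 < d)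
    (L := fun i => φ ⁻¹' K i) (fun i => (hc i).preimage hφc)
    (fun i x hx y hy a b ha hb hab => by
      have h := hconv i hx hy ha hb hab
      simp only [Set.mem_preimage, φ] at h ⊢
      convert h using 1
      simp only [map_add, map_smul, smul_add]
      rw [show a • v + a • A x + (b • v + b • A y) = (a + b) • v + (a • A x + b • A y) by
        rw [add_smul]; abel, hab, one_smul])
    (fun i z hz => Set.mem_iInter.1 (hball z hz) i)
    -- Composing with φ gives an ellipsoid in the intersection with determinant det A · det A', to
    -- which the maximality of A applies.
    (fun A' v' h => by
      have h1 := hmax (A.comp A') (v + A v') fun z hz => Set.mem_iInter.2 fun i => by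
        have := h z hz i
        simpa [φ, add_assoc] using this
      have h2 : (A.comp A').det = A.det * A'.det := LinearMap.det_comp _ _
      rw [h2, abs_mul] at h1
      exact le_of_mul_le_mul_left (by simpa using h1) (abs_pos.2 hdet))
  simp only [← Set.preimage_iInter] at hincl hvol
  refine ⟨σ, hcard, ?_, ?_⟩
  · rw [volume_preimage_affine hdet, volume_preimage_affine hdet, mul_left_comm] at hvol
    have hne : ENNReal.ofReal |A.det⁻¹| ≠ 0 := by simpa using hdet
    exact (ENNReal.mul_le_mul_iff_right hne ENNReal.ofReal_ne_top).1 hvol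
  · refine Metric.ediam_le fun x hx y hy => ?_
    obtain ⟨x, rfl⟩ := hsurj x
    obtain ⟨y, rfl⟩ := hsurj y
    set m : ℝ := (d : ℝ) * (d + 2)
    have h1 : edist (φ (-(m⁻¹ • x))) (φ (-(m⁻¹ • y))) ≤ Metric.ediam (⋂ i, K i) :=
      Metric.edist_le_ediam_of_mem (hincl x hx) (hincl y hy)
    have hm : 0 < m := by positivity
    have hdist : edist (φ x) (φ y) =
        ENNReal.ofReal m * edist (φ (-(m⁻¹ • x))) (φ (-(m⁻¹ • y))) := by
      rw [edist_dist, edist_dist, ← ENNReal.ofReal_mul hm.le]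
      congr 1
      simp only [φ, dist_add_left, map_neg, map_smul, dist_neg_neg, dist_smul₀,
        Real.norm_of_nonneg (inv_pos.2 hm).le]
      field_simp
    rw [hdist]
    refine mul_le_mul' ?_ h1
    -- For positive d, d(d + 2) ≤ 2d² is exactly d ≥ 2.
    have hd2 : (2 : ℝ) ≤ d := by exact_mod_cast hd
    calc ENNReal.ofReal m ≤ ENNReal.ofReal (2 * (d : ℝ) ^ 2) :=
          ENNReal.ofReal_le_ofReal (by simp only [m]; nlinarith)
      _ = 2 * (d : ℝ≥0∞) ^ 2 := by
          rw [ENNReal.ofReal_mul zero_le_two, ENNReal.ofReal_pow d.cast_nonneg]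
          simp

/-! ### Intersections that may have empty interior. -/

/-- Thickening every set gives the intersection interior points. The thickened intersections are
compact and decrease to the original one, so eventually they lie in its δ-thickening. -/
theorem exists_subfamily_cthickening {d : ℕ} (hd : 2 ≤ d) {ι : Type*} [Finite ι] [Nonempty ι]
    {K : ι → Set (EuclideanSpace ℝ (Fin d))} (hK : ∀ i, IsConvexBody (K i))
    (hne : (⋂ i, K i).Nonempty) {δ : NNReal} (hδ : 0 < δ) :
    ∃ σ : Finset ι, σ.card ≤ 2 * d ∧
      volume (⋂ i ∈ σ, K i) ≤ ENNReal.ofReal ((16 * (d : ℝ)) ^ (3 * (d : ℝ) / 2)) *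
        volume (Metric.cthickening δ (⋂ i, K i)) ∧
      Metric.ediam (⋂ i ∈ σ, K i) ≤
        2 * (d : ℝ≥0∞) ^ 2 * (Metric.ediam (⋂ i, K i) + 2 * δ) := by
  set N : ℕ → Set (EuclideanSpace ℝ (Fin d)) :=
    fun m => ⋂ i, Metric.cthickening (1 / ((m : ℝ) + 1)) (K i)
  have hpos : ∀ m : ℕ, (0 : ℝ) < 1 / ((m : ℝ) + 1) := fun m => by positivity
  have hcompact : ∀ m, IsCompact (N m) := fun m =>
    ((hK (Classical.arbitrary ι)).2.1.cthickening).of_isClosed_subset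
      (isClosed_iInter fun i => Metric.isClosed_cthickening) (Set.iInter_subset _ _)
  have hanti : Antitone N := fun a b hab =>
    Set.iInter_mono fun i => Metric.cthickening_mono (Nat.one_div_le_one_div hab) _
  have hinter : ⋂ m, N m ⊆ ⋂ i, K i := fun x hx => Set.mem_iInter.2 fun i => by
    rw [← (hK i).2.1.isClosed.closure_eq, ← Metric.cthickening_zero]
    rw [Metric.mem_cthickening_iff, ENNReal.ofReal_zero, nonpos_iff_eq_zero]
    have hlim : Tendsto (fun m : ℕ => ENNReal.ofReal (1 / ((m : ℝ) + 1))) atTop (𝓝 0) := by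
      simpa using ENNReal.tendsto_ofReal tendsto_one_div_add_atTop_nhds_zero_nat
    exact nonpos_iff_eq_zero.1 (ge_of_tendsto' hlim fun m =>
      Metric.mem_cthickening_iff.1 (Set.mem_iInter.1 (Set.mem_iInter.1 hx m) i))
  obtain ⟨m, hm⟩ := exists_subset_nhds_of_isCompact (V := N)
    (U := Metric.thickening δ (⋂ i, K i)) hanti.directed_ge hcompact fun x hx =>
      Metric.isOpen_thickening.mem_nhds (Metric.self_subset_thickening (by exact_mod_cast hδ) _
        (hinter hx))
  have hbody : IsConvexBody (N m) := by
    refine ⟨convex_iInter fun i => (hK i).1.cthickening _, hcompact m, ?_⟩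
    obtain ⟨x, hx⟩ := hne
    refine ⟨x, mem_interior.2 ⟨Metric.ball x (1 / ((m : ℝ) + 1)), fun y hy => ?_,
      Metric.isOpen_ball, Metric.mem_ball_self (hpos m)⟩⟩
    exact Set.mem_iInter.2 fun i => Metric.thickening_subset_cthickening _ _
      (Metric.mem_thickening_iff.2 ⟨x, Set.mem_iInter.1 hx i, hy⟩)
  obtain ⟨σ, hcard, hvol, hdiam⟩ := exists_subfamily_volume_ediam hd
    (fun i => Metric.isClosed_cthickening) (fun i => (hK i).1.cthickening _) hbody
  have hsub : ⋂ i ∈ σ, K i ⊆ ⋂ i ∈ σ, Metric.cthickening (1 / ((m : ℝ) + 1)) (K i) :=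
    Set.iInter₂_mono fun i _ => Metric.self_subset_cthickening _
  refine ⟨σ, hcard, (measure_mono hsub).trans (hvol.trans ?_),
    (Metric.ediam_mono hsub).trans (hdiam.trans ?_)⟩
  · gcongr
    exact hm.trans (Metric.thickening_subset_cthickening _ _)
  · gcongr
    exact (Metric.ediam_mono hm).trans (Metric.ediam_thickening_le δ)

theorem exists_subfamily_of_convexBodies {d : ℕ} (hd : 2 ≤ d) {ι : Type*} [Finite ι]
    {K : ι → Set (EuclideanSpace ℝ (Fin d))} (hK : ∀ i, IsConvexBody (K i)) :
    ∃ σ : Finset ι, σ.card ≤ 2 * d ∧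
      volume (⋂ i ∈ σ, K i) ≤ ENNReal.ofReal ((16 * (d : ℝ)) ^ (3 * (d : ℝ) / 2)) *
        volume (⋂ i, K i) ∧
      Metric.ediam (⋂ i ∈ σ, K i) ≤ 2 * (d : ℝ≥0∞) ^ 2 * Metric.ediam (⋂ i, K i) := by
  have hd2 : (2 : ℝ) ≤ d := by exact_mod_cast hd
  rcases isEmpty_or_nonempty ι with hι | hι
  -- For the empty family both intersections are the whole space, so only constants at least 1 are
  -- needed.
  · refine ⟨∅, by simp, ?_, ?_⟩
    · simp only [Finset.notMem_empty, Set.iInter_of_empty]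
      refine le_mul_of_one_le_left' ?_
      rw [ENNReal.one_le_ofReal]
      exact Real.one_le_rpow (by linarith) (by linarith)
    · simp only [Finset.notMem_empty, Set.iInter_of_empty]
      refine le_mul_of_one_le_left' ?_
      have : 1 ≤ 2 * d ^ 2 := by nlinarith
      exact_mod_cast this
  rcases Set.eq_empty_or_nonempty (⋂ i, K i) with hempty | hne
  · cases nonempty_fintype ι
    obtain ⟨σ, hσ, hσe⟩ : ∃ σ : Finset ι, σ.card ≤ d + 1 ∧ ⋂ i ∈ σ, K i = ∅ := by
      by_contra! hcon
      have := Convex.helly_theorem' (𝕜 := ℝ) (s := Finset.univ) (F := K) (fun i _ => (hK i).1)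
        fun I _ hI => hcon I (by simpa using hI)
      simp [hempty] at this
    exact ⟨σ, by omega, by simp [hσe], by simp [hσe]⟩
  · choose σ hcard hvol hdiam using fun m : ℕ => exists_subfamily_cthickening hd hK hne
      (δ := 1 / ((m : NNReal) + 1)) (by positivity)
    -- There are finitely many index sets, so one is selected for infinitely many δ → 0; the bounds
    -- for it pass to the limit.
    obtain ⟨τ, hτ⟩ := Finite.exists_infinite_fiber σ
    have hfreq : ∃ᶠ m in atTop, σ m = τ :=
      Nat.frequently_atTop_iff_infinite.2 (Set.infinite_coe_iff.1 hτ)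
    obtain ⟨m₀, hm₀⟩ := hfreq.exists
    have hlim : Tendsto (fun m : ℕ => 1 / ((m : NNReal) + 1)) atTop (𝓝 0) :=
      tendsto_one_div_add_atTop_nhds_zero_nat
    have hcomp : IsCompact (⋂ i, K i) :=
      (hK (Classical.arbitrary ι)).2.1.of_isClosed_subset
        (isClosed_iInter fun i => (hK i).2.1.isClosed) (Set.iInter_subset _ _)
    refine ⟨τ, hm₀ ▸ hcard m₀, ?_, ?_⟩
    · have h1 : Tendsto (fun m : ℕ => ((1 / ((m : NNReal) + 1) : NNReal) : ℝ)) atTop (𝓝 0) :=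
        NNReal.tendsto_coe.2 hlim
      refine ge_of_tendsto_of_frequently (ENNReal.Tendsto.const_mul
        ((tendsto_measure_cthickening_of_isCompact (μ := volume) hcomp).comp h1)
        (Or.inr ENNReal.ofReal_ne_top)) (hfreq.mono fun m hm => ?_)
      rw [← hm]
      exact hvol m
    · have h1 : Tendsto (fun m : ℕ => 2 * (d : ℝ≥0∞) ^ 2 * (Metric.ediam (⋂ i, K i) +
          2 * ((1 / ((m : NNReal) + 1) : NNReal) : ℝ≥0∞))) atTop
          (𝓝 (2 * (d : ℝ≥0∞) ^ 2 * (Metric.ediam (⋂ i, K i) + 2 * ((0 : NNReal) : ℝ≥0∞)))) := by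
        refine ENNReal.Tendsto.const_mul (Tendsto.const_add _ ?_) (Or.inr ?_)
        · exact ENNReal.Tendsto.const_mul (ENNReal.tendsto_coe.2 hlim) (Or.inr (by simp))
        · exact ENNReal.mul_ne_top (by simp) (by simp)
      rw [ENNReal.coe_zero, mul_zero, add_zero] at h1
      refine ge_of_tendsto_of_frequently h1 (hfreq.mono fun m hm => ?_)
      rw [← hm]
      exact hdiam m

theorem theorem2 :
    ∃ c : ℝ, 0 < c ∧ ∀ d : ℕ, 2 ≤ d →
      (∀ (n : ℕ) (K : Fin n → Set (EuclideanSpace ℝ (Fin d))),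
        (∀ i, IsClosed (K i)) → (∀ i, Convex ℝ (K i)) → IsConvexBody (⋂ i, K i) →
          ∃ σ : Finset (Fin n), σ.card ≤ 2 * d ∧
            MeasureTheory.volume (⋂ i ∈ σ, K i) ≤
              ENNReal.ofReal ((c * (d : ℝ)) ^ (3 * (d : ℝ) / 2)) *
                MeasureTheory.volume (⋂ i, K i) ∧
            Metric.ediam (⋂ i ∈ σ, K i) ≤ 2 * (d : ℝ≥0∞) ^ 2 * Metric.ediam (⋂ i, K i)) ∧
      volumeHellyConst d ≤ ENNReal.ofReal ((c * (d : ℝ)) ^ (3 * (d : ℝ) / 2)) ∧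
      diameterHellyConst d ≤ 2 * (d : ℝ≥0∞) ^ 2 := by
  refine ⟨16, by norm_num, fun d hd => ⟨fun n K hc hconv hK =>
    exists_subfamily_volume_ediam hd hc hconv hK, sInf_le fun n K hK => ?_,
    sInf_le fun n K hK => ?_⟩⟩
  · obtain ⟨σ, hcard, hvol, -⟩ := exists_subfamily_of_convexBodies hd hK
    exact ⟨σ, hcard, hvol⟩
  · obtain ⟨σ, hcard, -, hdiam⟩ := exists_subfamily_of_convexBodies hd hK
    exact ⟨σ, hcard, hdiam⟩
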